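/- Let $G:\mathbb{R}^{n}\to\mathbb{R}^{n\times m}$ be locally Lipschitz, let $Q\in\mathbb{R}^{n\times n}$ and $R\in\mathbb{R}^{m\times m}$ be symmetric positive definite, and let $U\subseteq\mathbb{R}^m$ be an input constraint set with $0\in U$. For a horizon $T>0$, a time $t$ and a state $\xi$, consider the optimal control problem without terminal cost or terminal constraint $$\min_{u}\int_t^{t+T}\bigl(x(\tau)^\top Qx(\tau)+u(\tau)^\top Ru(\tau)\bigr)\,d\tau\quad\text{subject to}\quad \dot x=G(x)u,\quad x(t)=\xi,\quad u(\tau)\in U\ \ (t\le\tau<t+T),$$ over square-integrable controls $u$ whose absolutely continuous solution $x$ exists on $[t,t+T]$. For a sampling time $\delta\in(0,T]$, the model predictive control (MPC) closed loop is obtained by solving this problem at each $t=k\delta$, $k=0,1,2,\dots$, with $\xi=x(k\delta)$, and applying an optimal control on $[k\delta,(k+1)\delta)$. Suppose that for every $\varepsilon>0$ there is an $x_0\neq0$ with $\|x_0\|_2\le\varepsilon$ and $x_0^\top QG(x_0)=0$. Then for every horizon $T>0$: 1. There is a $\rho>0$ such that, for every $x_0\ne0$ with $\|x_0\|_2\le\rho$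 and $x_0^\top QG(x_0)=0$, the control $u^\star\equiv0$ is the unique (up to null sets) optimal control from the initial state $x_0$, and for every sampling time $\delta\in(0,T]$ the MPC closed loop started at $x_0$ exists and stays at $x_0$ for all times. 2. For every sampling time $\delta\in(0,T]$, the origin is not asymptotically stable (Lyapunov stable and locally attractive) for the MPC closed loop. -/

import Mathlib

open MeasureTheory Set Filter Topology

namespace MPC

/-- `ẋ = G(x) u`, the velocity of the driftless input-affine system. -/
def velocity {n m : ℕ} (G : EuclideanSpace ℝ (Fin n) → Matrix (Fin n) (Fin m) ℝ)
    (x : EuclideanSpace ℝ (Fin n)) (u : EuclideanSpace ℝ (Fin m)) : EuclideanSpace ℝ (Fin n) :=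
  WithLp.toLp 2 ((G x).mulVec u.ofLp)

/-- `x` is the (Carathéodory, i.e. absolutely continuous) solution on `[a, b]` of `ẋ = G(x) u`
with `x(a) = ξ`. -/
def IsTrajectory {n m : ℕ} (G : EuclideanSpace ℝ (Fin n) → Matrix (Fin n) (Fin m) ℝ)
    (a b : ℝ) (ξ : EuclideanSpace ℝ (Fin n))
    (u : ℝ → EuclideanSpace ℝ (Fin m)) (x : ℝ → EuclideanSpace ℝ (Fin n)) : Prop :=
  ContinuousOn x (Icc a b) ∧
  IntervalIntegrable (fun τ => velocity G (x τ) (u τ)) volume a b ∧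
  ∀ s ∈ Icc a b, x s = ξ + ∫ τ in a..s, velocity G (x τ) (u τ)

/-- The quadratic stage cost `xᵀ Q x + uᵀ R u`. -/
def stageCost {n m : ℕ} (Q : Matrix (Fin n) (Fin n) ℝ) (R : Matrix (Fin m) (Fin m) ℝ)
    (x : EuclideanSpace ℝ (Fin n)) (u : EuclideanSpace ℝ (Fin m)) : ℝ :=
  x.ofLp ⬝ᵥ Q.mulVec x.ofLp + u.ofLp ⬝ᵥ R.mulVec u.ofLp

/-- The cost of a predicted pair over the horizon `[t, t + T]` (no terminal cost). -/
noncomputable def cost {n m : ℕ} (Q : Matrix (Fin n) (Fin n) ℝ) (R : Matrix (Fin m) (Fin m) ℝ)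
    (t T : ℝ) (u : ℝ → EuclideanSpace ℝ (Fin m)) (x : ℝ → EuclideanSpace ℝ (Fin n)) : ℝ :=
  ∫ τ in t..(t + T), stageCost Q R (x τ) (u τ)

/-- `(u, x)` satisfies the constraints of the optimal control problem on `[t, t + T]` with
measured state `ξ`. Controls are measurable and square-integrable, which for positive definite
weights is the same as having finite cost. There is no terminal constraint. -/
def IsFeasible {n m : ℕ} (G : EuclideanSpace ℝ (Fin n) → Matrix (Fin n) (Fin m) ℝ)
    (U : Set (EuclideanSpace ℝ (Fin m))) (t T : ℝ) (ξ : EuclideanSpace ℝ (Fin n))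
    (u : ℝ → EuclideanSpace ℝ (Fin m)) (x : ℝ → EuclideanSpace ℝ (Fin n)) : Prop :=
  MemLp u 2 (volume.restrict (Icc t (t + T))) ∧
  (∀ τ ∈ Ico t (t + T), u τ ∈ U) ∧
  IsTrajectory G t (t + T) ξ u x

/-- `u` is a (globally) optimal control of the optimal control problem solved at time `t` with
measured state `ξ` and horizon `T`. -/
def IsOptimalControl {n m : ℕ} (G : EuclideanSpace ℝ (Fin n) → Matrix (Fin n) (Fin m) ℝ)
    (Q : Matrix (Fin n) (Fin n) ℝ) (R : Matrix (Fin m) (Fin m) ℝ)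
    (U : Set (EuclideanSpace ℝ (Fin m))) (t T : ℝ) (ξ : EuclideanSpace ℝ (Fin n))
    (u : ℝ → EuclideanSpace ℝ (Fin m)) : Prop :=
  ∃ x, IsFeasible G U t T ξ u x ∧
    ∀ v y, IsFeasible G U t T ξ v y → cost Q R t T u x ≤ cost Q R t T v y

/-- `(u, x)` is an input/state evolution on `[0, ∞)` of the receding-horizon closed loop with
sampling time `δ`: at each `k δ` an optimal control for the current state is computed and its
restriction to `[k δ, (k + 1) δ)` is applied to the system. -/
def IsClosedLoop {n m : ℕ} (G : EuclideanSpace ℝ (Fin n) → Matrix (Fin n) (Fin m) ℝ)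
    (Q : Matrix (Fin n) (Fin n) ℝ) (R : Matrix (Fin m) (Fin m) ℝ)
    (U : Set (EuclideanSpace ℝ (Fin m))) (T δ : ℝ)
    (u : ℝ → EuclideanSpace ℝ (Fin m)) (x : ℝ → EuclideanSpace ℝ (Fin n)) : Prop :=
  ∀ k : ℕ,
    (∃ v, IsOptimalControl G Q R U (k * δ) T (x (k * δ)) v ∧
      ∀ τ ∈ Ico (k * δ) ((k + 1) * δ), u τ = v τ) ∧
    IsTrajectory G (k * δ) ((k + 1) * δ) (x (k * δ)) u x

/-- The origin is (locally) asymptotically stable for the closed loop: it is stable in the sense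
of Lyapunov and locally attractive. -/
def IsAsymptoticallyStable {n m : ℕ}
    (G : EuclideanSpace ℝ (Fin n) → Matrix (Fin n) (Fin m) ℝ)
    (Q : Matrix (Fin n) (Fin n) ℝ) (R : Matrix (Fin m) (Fin m) ℝ)
    (U : Set (EuclideanSpace ℝ (Fin m))) (T δ : ℝ) : Prop :=
  (∀ ε > 0, ∃ r > 0, ∀ u x, IsClosedLoop G Q R U T δ u x → ‖x 0‖ ≤ r →
    ∀ t, 0 ≤ t → ‖x t‖ ≤ ε) ∧
  (∃ r > 0, ∀ u x, IsClosedLoop G Q R U T δ u x → ‖x 0‖ ≤ r → Tendsto x atTop (𝓝 0))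

end MPC

/-!
Let `ξ` be small with `ξᵀ Q G(ξ) = 0`, and put `w = Q ξ`. The constant trajectory with control `0`
costs `T ξᵀ Q ξ`. By convexity, `xᵀ Q x ≥ ξᵀ Q ξ + 2 ⟪w, x - ξ⟫` (`MPC.le_quadForm`), so a feasible
pair `(u, x)` can save state cost only through the term `⟪w, x - ξ⟫ = ∫ ⟪w, G(x) u⟫`. Since
`⟪w, G(ξ) u⟫ = 0`, the integrand equals `⟪w, (G(x) - G(ξ)) u⟫`. By the Lipschitz bound and
`‖x - ξ‖ ≤ M ∫ ‖u‖`, the saving is at most a constant times `‖ξ‖ (∫ ‖u‖)²`, hence at most a constant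
times `‖ξ‖ ∫ ‖u‖²` by Cauchy-Schwarz. For small `ξ` this is less than half of the input cost, which
is bounded below by a multiple of `∫ ‖u‖²`.

The argument needs `x` to stay in a fixed ball around the origin, where the bounds on `G` hold.
A trajectory that may leave this ball has `∫ ‖u‖²` bounded away from `0`, and then the input cost
alone exceeds `T ξᵀ Q ξ` once `ξ` is small. Both cases together give `MPC.exists_cost_ge`: the cost
is at least `T ξᵀ Q ξ + c ∫ ‖u‖²` with `c > 0`. So `0` is the unique optimal control at `ξ`, and by
induction on the sampling instants the closed loop never leaves `ξ` (`MPC.IsClosedLoop.eq_const`).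
Such equilibria exist arbitrarily close to the origin, which is therefore not attractive.
-/

/-! ### Matrices and quadratic forms on Euclidean space -/

theorem norm_toLp_le_sum {n : ℕ} (v : Fin n → ℝ) :
    ‖(WithLp.toLp 2 v : EuclideanSpace ℝ (Fin n))‖ ≤ ∑ i, |v i| := by
  rw [EuclideanSpace.norm_eq]
  refine Real.sqrt_le_iff.2 ⟨Finset.sum_nonneg fun i _ => abs_nonneg _, ?_⟩
  simpa using Finset.sum_sq_le_sq_sum_of_nonneg (s := Finset.univ) fun i _ => abs_nonneg (v i)

theorem norm_toLp_mulVec_le {n m : ℕ} (A : Matrix (Fin n) (Fin m) ℝ)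
    (u : EuclideanSpace ℝ (Fin m)) :
    ‖(WithLp.toLp 2 (A.mulVec u.ofLp) : EuclideanSpace ℝ (Fin n))‖ ≤
      (∑ i, ∑ j, |A i j|) * ‖u‖ := by
  refine (norm_toLp_le_sum _).trans ?_
  rw [Finset.sum_mul]
  refine Finset.sum_le_sum fun i _ => ?_
  rw [Finset.sum_mul]
  refine (Finset.abs_sum_le_sum_abs (fun j => A i j * u j) Finset.univ).trans
    (Finset.sum_le_sum fun j _ => ?_)
  rw [abs_mul]
  gcongr
  exact PiLp.norm_apply_le u j

theorem dotProduct_ofLp_eq_inner {n : ℕ} (x y : EuclideanSpace ℝ (Fin n)) :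
    x.ofLp ⬝ᵥ y.ofLp = inner ℝ x y := by
  rw [EuclideanSpace.inner_eq_star_dotProduct, dotProduct_comm]
  simp

theorem abs_quadForm_le {n : ℕ} (A : Matrix (Fin n) (Fin n) ℝ) (x : EuclideanSpace ℝ (Fin n)) :
    |x.ofLp ⬝ᵥ A.mulVec x.ofLp| ≤ (∑ i, ∑ j, |A i j|) * ‖x‖ ^ 2 := by
  have h := abs_real_inner_le_norm x (WithLp.toLp 2 (A.mulVec x.ofLp))
  rw [← dotProduct_ofLp_eq_inner] at h
  refine h.trans ((mul_le_mul_of_nonneg_left (norm_toLp_mulVec_le A x) (norm_nonneg x)).trans_eq ?_)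
  ring

theorem continuous_quadForm {n : ℕ} (A : Matrix (Fin n) (Fin n) ℝ) :
    Continuous fun x : EuclideanSpace ℝ (Fin n) => x.ofLp ⬝ᵥ A.mulVec x.ofLp := by
  unfold dotProduct Matrix.mulVec dotProduct
  fun_prop

/-- The constant is the minimum of the quadratic form on the unit sphere. -/
theorem Matrix.PosDef.exists_pos_mul_norm_sq_le {n : ℕ} {A : Matrix (Fin n) (Fin n) ℝ}
    (hA : A.PosDef) :
    ∃ c > 0, ∀ x : EuclideanSpace ℝ (Fin n), c * ‖x‖ ^ 2 ≤ x.ofLp ⬝ᵥ A.mulVec x.ofLp := by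
  have hpos : ∀ x : EuclideanSpace ℝ (Fin n), x ≠ 0 → 0 < x.ofLp ⬝ᵥ A.mulVec x.ofLp := by
    intro x hx
    have := hA.dotProduct_mulVec_pos (x := x.ofLp) (by simpa using hx)
    simpa using this
  rcases (Metric.sphere (0 : EuclideanSpace ℝ (Fin n)) 1).eq_empty_or_nonempty with he | hne
  · refine ⟨1, one_pos, fun x => ?_⟩
    have hx : x = 0 := by
      by_contra hx
      have : ‖x‖⁻¹ • x ∈ Metric.sphere (0 : EuclideanSpace ℝ (Fin n)) 1 := by
        simp [norm_smul, hx]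
      simp [he] at this
    simp [hx]
  · obtain ⟨z, hz, hmin⟩ := (isCompact_sphere (0 : EuclideanSpace ℝ (Fin n)) 1).exists_isMinOn hne
      (continuous_quadForm A).continuousOn
    have hz0 : z ≠ 0 := by
      rintro rfl
      simp at hz
    refine ⟨_, hpos z hz0, fun x => ?_⟩
    rcases eq_or_ne x 0 with rfl | hx
    · simp
    have hx' : 0 < ‖x‖ := norm_pos_iff.2 hx
    have := hmin (show ‖x‖⁻¹ • x ∈ Metric.sphere (0 : EuclideanSpace ℝ (Fin n)) 1 by
        simp [norm_smul, hx])
    simp only [mem_ofPred_eq, WithLp.ofLp_smul, Matrix.mulVec_smul, dotProduct_smul, smul_dotProduct,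
      smul_eq_mul] at this
    calc _ ≤ (‖x‖⁻¹ * (‖x‖⁻¹ * (x.ofLp ⬝ᵥ A.mulVec x.ofLp))) * ‖x‖ ^ 2 := by gcongr
      _ = _ := by field_simp

/-! ### The Cauchy-Schwarz inequality on an interval -/

theorem sq_intervalIntegral_le {f : ℝ → ℝ} {a b : ℝ} (hab : a < b)
    (hf : IntervalIntegrable f volume a b)
    (hf2 : IntervalIntegrable (fun t => f t ^ 2) volume a b) :
    (∫ t in a..b, f t) ^ 2 ≤ (b - a) * ∫ t in a..b, f t ^ 2 := by
  set A := ∫ t in a..b, f t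
  set I := ∫ t in a..b, f t ^ 2
  have hba : 0 < b - a := sub_pos.2 hab
  -- The variance of `f` on `[a, b]` is nonnegative.
  have h0 : 0 ≤ ∫ t in a..b, (f t - A / (b - a)) ^ 2 :=
    intervalIntegral.integral_nonneg hab.le fun t _ => sq_nonneg _
  have h1 : ∫ t in a..b, (f t - A / (b - a)) ^ 2 = I - A ^ 2 / (b - a) := by
    have : ∀ t, (f t - A / (b - a)) ^ 2
        = f t ^ 2 - 2 * (A / (b - a)) * f t + (A / (b - a)) ^ 2 := fun t => by ring
    simp_rw [this]
    rw [intervalIntegral.integral_add (hf2.sub (hf.const_mul _)) intervalIntegrable_const,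
      intervalIntegral.integral_sub hf2 (hf.const_mul _), intervalIntegral.integral_const_mul,
      intervalIntegral.integral_const, smul_eq_mul]
    change I - 2 * (A / (b - a)) * A + _ = _
    field_simp
    ring
  rw [h1, sub_nonneg, div_le_iff₀ hba] at h0
  linarith

/-! ### Bounds on the velocity near the origin -/

namespace MPC

/-- Growth and Lipschitz bounds for the velocity on a ball around the origin, uniform in the input
up to the factor `‖u‖`. -/
theorem exists_velocity_bounds {n m : ℕ} (G : EuclideanSpace ℝ (Fin n) → Matrix (Fin n) (Fin m) ℝ)
    (hG : ∀ i j, LocallyLipschitz (fun x => G x i j)) :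
    ∃ r > 0, ∃ M > 0, ∃ L ≥ 0, ∀ x, ‖x‖ ≤ r → ∀ u,
      ‖velocity G x u‖ ≤ M * ‖u‖ ∧
      ∀ y, ‖y‖ ≤ r → ‖velocity G x u - velocity G y u‖ ≤ L * ‖x - y‖ * ‖u‖ := by
  choose K s hs hK using fun i j => hG i j 0
  have hS : (⋂ i, ⋂ j, s i j) ∈ 𝓝 (0 : EuclideanSpace ℝ (Fin n)) :=
    Filter.iInter_mem.2 fun i => Filter.iInter_mem.2 fun j => hs i j
  obtain ⟨r, hr, hrS⟩ := Metric.nhds_basis_closedBall.mem_iff.1 hS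
  have hlip : ∀ x y, ‖x‖ ≤ r → ‖y‖ ≤ r → ∀ u,
      ‖velocity G x u - velocity G y u‖ ≤ (∑ i, ∑ j, (K i j : ℝ)) * ‖x - y‖ * ‖u‖ := by
    intro x y hx hy u
    have hxS := hrS (mem_closedBall_zero_iff.2 hx)
    have hyS := hrS (mem_closedBall_zero_iff.2 hy)
    simp only [mem_iInter] at hxS hyS
    have : velocity G x u - velocity G y u = WithLp.toLp 2 ((G x - G y).mulVec u.ofLp) := by
      rw [Matrix.sub_mulVec, WithLp.toLp_sub]; rfl
    rw [this]
    refine (norm_toLp_mulVec_le _ _).trans ?_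
    gcongr
    simp_rw [Finset.sum_mul]
    gcongr with i _ j _
    have := (hK i j).dist_le_mul x (hxS i j) y (hyS i j)
    rwa [Real.dist_eq, dist_eq_norm] at this
  have hL : 0 ≤ ∑ i, ∑ j, (K i j : ℝ) :=
    Finset.sum_nonneg fun i _ => Finset.sum_nonneg fun j _ => (K i j).2
  refine ⟨r, hr, (∑ i, ∑ j, (K i j : ℝ)) * r + (∑ i, ∑ j, |G 0 i j|) + 1, by positivity,
    _, hL, fun x hx u => ⟨?_, fun y hy => hlip x y hx hy u⟩⟩
  have h0 := hlip x 0 hx (by simpa using hr.le) u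
  have h1 : ‖velocity G 0 u‖ ≤ (∑ i, ∑ j, |G 0 i j|) * ‖u‖ := norm_toLp_mulVec_le _ _
  have h2 := norm_le_norm_sub_add (velocity G x u) (velocity G 0 u)
  rw [sub_zero] at h0
  have h3 : (∑ i, ∑ j, (K i j : ℝ)) * ‖x‖ * ‖u‖ ≤ (∑ i, ∑ j, (K i j : ℝ)) * r * ‖u‖ := by gcongr
  nlinarith [norm_nonneg u]

/-! ### Integrability and lower bounds for the cost -/

variable {n m : ℕ} {G : EuclideanSpace ℝ (Fin n) → Matrix (Fin n) (Fin m) ℝ}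
  {Q : Matrix (Fin n) (Fin n) ℝ} {R : Matrix (Fin m) (Fin m) ℝ}
  {U : Set (EuclideanSpace ℝ (Fin m))} {t T : ℝ} {ξ : EuclideanSpace ℝ (Fin n)}
  {u : ℝ → EuclideanSpace ℝ (Fin m)} {x : ℝ → EuclideanSpace ℝ (Fin n)}

@[simp]
theorem velocity_zero (x : EuclideanSpace ℝ (Fin n)) : velocity G x 0 = 0 := by
  simp [velocity]

theorem IsFeasible.intervalIntegrable_norm (hT : 0 < T) (h : IsFeasible G U t T ξ u x) :
    IntervalIntegrable (fun τ => ‖u τ‖) volume t (t + T) := by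
  rw [intervalIntegrable_iff_integrableOn_Icc_of_le (by linarith)]
  exact (h.1.integrable one_le_two).norm

theorem IsFeasible.intervalIntegrable_norm_sq (hT : 0 < T) (h : IsFeasible G U t T ξ u x) :
    IntervalIntegrable (fun τ => ‖u τ‖ ^ 2) volume t (t + T) := by
  rw [intervalIntegrable_iff_integrableOn_Icc_of_le (by linarith)]
  exact h.1.norm.integrable_sq

/-- The cost of a feasible pair is the integral of an integrable function, so it is never a junk
value. -/
theorem IsFeasible.intervalIntegrable_stageCost (hT : 0 < T) (h : IsFeasible G U t T ξ u x) :
    IntervalIntegrable (fun τ => stageCost Q R (x τ) (u τ)) volume t (t + T) := by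
  refine IntervalIntegrable.add ?_ ?_
  · refine ContinuousOn.intervalIntegrable ?_
    rw [uIcc_of_le (by linarith)]
    exact (continuous_quadForm Q).comp_continuousOn h.2.2.1
  · rw [intervalIntegrable_iff_integrableOn_Icc_of_le (by linarith)]
    refine (h.1.norm.integrable_sq.const_mul (∑ i, ∑ j, |R i j|)).mono'
      ((continuous_quadForm R).comp_aestronglyMeasurable h.1.1) (ae_of_all _ fun τ => ?_)
    exact abs_quadForm_le R (u τ)

theorem IsFeasible.le_cost (hT : 0 < T) (h : IsFeasible G U t T ξ u x) {c lam : ℝ}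
    (hR : ∀ v : EuclideanSpace ℝ (Fin m), lam * ‖v‖ ^ 2 ≤ v.ofLp ⬝ᵥ R.mulVec v.ofLp)
    (hc : ∀ s ∈ Icc t (t + T), c ≤ (x s).ofLp ⬝ᵥ Q.mulVec (x s).ofLp) :
    T * c + lam * (∫ τ in t..(t + T), ‖u τ‖ ^ 2) ≤ cost Q R t T u x := by
  have h2 := h.intervalIntegrable_norm_sq hT
  calc T * c + lam * (∫ τ in t..(t + T), ‖u τ‖ ^ 2)
      = ∫ τ in t..(t + T), (c + lam * ‖u τ‖ ^ 2) := by
        rw [intervalIntegral.integral_add intervalIntegrable_const (h2.const_mul _)]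
        simp
    _ ≤ _ := intervalIntegral.integral_mono_on (by linarith)
        (intervalIntegrable_const.add (h2.const_mul _)) (h.intervalIntegrable_stageCost hT)
        fun s hs => add_le_add (hc s hs) (hR (u s))

/-! ### A priori bounds on trajectories -/

theorem IsTrajectory.norm_sub_le {a b M : ℝ} (h : IsTrajectory G a b ξ u x)
    (hu : IntervalIntegrable (fun τ => ‖u τ‖) volume a b) {s : ℝ} (hs : s ∈ Icc a b)
    (hM : ∀ τ ∈ Ioo a s, ‖velocity G (x τ) (u τ)‖ ≤ M * ‖u τ‖) (hM0 : 0 ≤ M) :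
    ‖x s - ξ‖ ≤ M * ∫ τ in a..b, ‖u τ‖ := by
  rw [h.2.2 s hs, add_sub_cancel_left]
  have hsub : uIcc a s ⊆ uIcc a b := by
    rw [uIcc_of_le hs.1, uIcc_of_le (hs.1.trans hs.2)]
    exact Icc_subset_Icc_right hs.2
  have hus : IntervalIntegrable (fun τ => ‖u τ‖) volume a s := hu.mono_set hsub
  calc ‖∫ τ in a..s, velocity G (x τ) (u τ)‖
      ≤ ∫ τ in a..s, ‖velocity G (x τ) (u τ)‖ :=
        intervalIntegral.norm_integral_le_integral_norm hs.1
    _ ≤ ∫ τ in a..s, M * ‖u τ‖ :=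
        intervalIntegral.integral_mono_on_of_le_Ioo hs.1 (h.2.1.mono_set hsub).norm
          (hus.const_mul M) hM
    _ = M * ∫ τ in a..s, ‖u τ‖ := intervalIntegral.integral_const_mul _ _
    _ ≤ _ := by
        gcongr
        exact intervalIntegral.integral_mono_interval le_rfl hs.1 hs.2
          (ae_of_all _ fun τ => norm_nonneg _) hu

/-- A control with small `L¹` norm keeps the trajectory in the ball of radius `r`, although the
velocity bound is assumed only there: up to the first time at which `x` has moved by `r / 2` that
bound holds, and it shows that `x` has moved by less. -/
theorem IsTrajectory.norm_le {a b r M : ℝ} (hM0 : 0 ≤ M)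
    (hM : ∀ y, ‖y‖ ≤ r → ∀ v, ‖velocity G y v‖ ≤ M * ‖v‖)
    (h : IsTrajectory G a b ξ u x) (hu : IntervalIntegrable (fun τ => ‖u τ‖) volume a b)
    (hξ : ‖ξ‖ ≤ r / 2) (hsmall : M * ∫ τ in a..b, ‖u τ‖ < r / 2) {s : ℝ} (hs : s ∈ Icc a b) :
    ‖x s‖ ≤ r := by
  have near : ∀ y : EuclideanSpace ℝ (Fin n), ‖y - ξ‖ < r / 2 → ‖y‖ ≤ r := fun y hy => by
    linarith [norm_le_norm_sub_add y ξ]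
  suffices hE : Icc a b ∩ {σ | r / 2 ≤ ‖x σ - ξ‖} = ∅ by
    refine near _ (not_le.1 fun hsr => ?_)
    exact (hE ▸ (⟨hs, hsr⟩ : s ∈ Icc a b ∩ {σ | r / 2 ≤ ‖x σ - ξ‖}) : s ∈ (∅ : Set ℝ))
  by_contra hne
  -- The first time at which the trajectory is at distance at least `r / 2` from its start.
  have hcpt : IsCompact (Icc a b ∩ {σ | r / 2 ≤ ‖x σ - ξ‖}) := by
    refine isCompact_Icc.of_isClosed_subset ?_ inter_subset_left
    exact (h.1.sub continuousOn_const).norm.preimage_isClosed_of_isClosed isClosed_Icc isClosed_Ici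
  obtain ⟨σ, ⟨hσ, hσr⟩, hmin⟩ := hcpt.exists_isLeast (nonempty_iff_ne_empty.2 hne)
  have := h.norm_sub_le hu hσ (fun τ hτ => hM _ (near _ (not_le.1 fun hτr => ?_)) _) hM0
  · exact absurd hσr (not_le.2 (this.trans_lt hsmall))
  · exact hτ.2.not_ge (hmin ⟨⟨hτ.1.le, hτ.2.le.trans hσ.2⟩, hτr⟩)

/-! ### Zero is the unique optimal control at critical states -/

/-- At a critical state every velocity `G(ξ) v` is tangent to the level set of `xᵀ Q x`. -/
theorem inner_velocity_eq_zero (hQ : Q.PosDef) (hξ : Matrix.vecMul ξ.ofLp (Q * G ξ) = 0)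
    (v : EuclideanSpace ℝ (Fin m)) :
    inner ℝ (WithLp.toLp 2 (Q.mulVec ξ.ofLp)) (velocity G ξ v) = 0 := by
  have hs : Q.transpose = Q := by simpa using hQ.isHermitian.eq
  rw [← dotProduct_ofLp_eq_inner]
  change Q.mulVec ξ.ofLp ⬝ᵥ (G ξ).mulVec v.ofLp = 0
  rw [Matrix.dotProduct_mulVec, ← Matrix.vecMul_transpose, hs, Matrix.vecMul_vecMul, hξ,
    zero_dotProduct]

/-- The tangent inequality of the convex function `y ↦ yᵀ Q y` at `ξ`. -/
theorem le_quadForm (hQ : Q.PosDef) (ξ y : EuclideanSpace ℝ (Fin n)) :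
    ξ.ofLp ⬝ᵥ Q.mulVec ξ.ofLp + 2 * inner ℝ (WithLp.toLp 2 (Q.mulVec ξ.ofLp)) (y - ξ) ≤
      y.ofLp ⬝ᵥ Q.mulVec y.ofLp := by
  have hs : Q.transpose = Q := by simpa using hQ.isHermitian.eq
  have h0 : 0 ≤ (y.ofLp - ξ.ofLp) ⬝ᵥ Q.mulVec (y.ofLp - ξ.ofLp) := by
    simpa using hQ.posSemidef.dotProduct_mulVec_nonneg (y.ofLp - ξ.ofLp)
  have hsym : ξ.ofLp ⬝ᵥ Q.mulVec y.ofLp = y.ofLp ⬝ᵥ Q.mulVec ξ.ofLp := by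
    rw [Matrix.dotProduct_mulVec, ← Matrix.mulVec_transpose, hs, dotProduct_comm]
  rw [← dotProduct_ofLp_eq_inner, WithLp.ofLp_sub,
    dotProduct_comm (Q.mulVec ξ.ofLp)]
  simp only [Matrix.mulVec_sub, sub_dotProduct, dotProduct_sub] at h0 ⊢
  linarith

/-- Near the origin, the cost from a critical state exceeds that of staying put by at least a
multiple of the squared `L²` norm of the control. -/
theorem exists_cost_ge (hG : ∀ i j, LocallyLipschitz (fun x => G x i j))
    (hQ : Q.PosDef) (hR : R.PosDef) (hT : 0 < T) :
    ∃ ρ > 0, ∃ c > 0, ∀ ξ : EuclideanSpace ℝ (Fin n), ‖ξ‖ ≤ ρ →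
      Matrix.vecMul ξ.ofLp (Q * G ξ) = 0 → ∀ U t u x, IsFeasible G U t T ξ u x →
      T * (ξ.ofLp ⬝ᵥ Q.mulVec ξ.ofLp) + c * (∫ τ in t..(t + T), ‖u τ‖ ^ 2) ≤ cost Q R t T u x := by
  obtain ⟨r, hr, M, hM, L, hL, hGb⟩ := exists_velocity_bounds G hG
  obtain ⟨lam, hlam, hRl⟩ := hR.exists_pos_mul_norm_sq_le
  set C := ∑ i, ∑ j, |Q i j|
  have hC0 : 0 ≤ C := Finset.sum_nonneg fun i _ => Finset.sum_nonneg fun j _ => abs_nonneg _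
  -- The second condition makes the input cost dominate the cross term, the third makes it
  -- dominate the cost of staying put when the trajectory may leave the ball of radius `r`.
  obtain ⟨ρ, ⟨⟨hρr, hρ1⟩, hρ2⟩, hρ⟩ : ∃ ρ : ℝ, ((ρ < r / 2 ∧ 2 * T ^ 2 * C * L * M * ρ < lam / 2) ∧
      T ^ 2 * (C * ρ ^ 2) * M ^ 2 < lam / 2 * (r / 2) ^ 2) ∧ 0 < ρ := by
    have e1 : ∀ᶠ ρ : ℝ in 𝓝 0, ρ < r / 2 := eventually_lt_nhds (by positivity)
    have e2 : ∀ᶠ ρ : ℝ in 𝓝 0, 2 * T ^ 2 * C * L * M * ρ < lam / 2 :=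
      ContinuousAt.eventually_lt (by fun_prop) continuousAt_const (by simpa)
    have e3 : ∀ᶠ ρ : ℝ in 𝓝 0, T ^ 2 * (C * ρ ^ 2) * M ^ 2 < lam / 2 * (r / 2) ^ 2 :=
      ContinuousAt.eventually_lt (by fun_prop) continuousAt_const (by simp; positivity)
    exact ((((e1.and e2).and e3).filter_mono nhdsWithin_le_nhds).and
      (self_mem_nhdsWithin : Ioi (0 : ℝ) ∈ 𝓝[>] 0)).exists
  refine ⟨ρ, hρ, lam / 2, by positivity, fun ξ hξ hcrit U t u x h => ?_⟩
  set w : EuclideanSpace ℝ (Fin n) := WithLp.toLp 2 (Q.mulVec ξ.ofLp)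
  have hwC : ‖w‖ ≤ C * ρ := (norm_toLp_mulVec_le Q ξ).trans (by gcongr)
  have hu1 := h.intervalIntegrable_norm hT
  have hcs := sq_intervalIntegral_le (by linarith) hu1 (h.intervalIntegrable_norm_sq hT)
  rw [add_sub_cancel_left] at hcs
  set A := ∫ τ in t..(t + T), ‖u τ‖
  set I := ∫ τ in t..(t + T), ‖u τ‖ ^ 2
  have hA0 : 0 ≤ A := intervalIntegral.integral_nonneg (by linarith) fun _ _ => norm_nonneg _
  -- Either the control is too weak for `x` to leave the ball, or its `L²` norm is large.
  rcases lt_or_ge (M * A) (r / 2) with hsmall | hlarge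
  · have hball : ∀ s ∈ Icc t (t + T), ‖x s‖ ≤ r := fun s hs =>
      h.2.2.norm_le hM.le (fun y hy v => (hGb y hy v).1) hu1 (hξ.trans hρr.le) hsmall hs
    have hdisp : ∀ s ∈ Icc t (t + T), ‖x s - ξ‖ ≤ M * A := fun s hs =>
      h.2.2.norm_sub_le hu1 hs (fun τ hτ =>
        (hGb _ (hball τ ⟨hτ.1.le, hτ.2.le.trans hs.2⟩) _).1) hM.le
    have hcross : ∀ s ∈ Icc t (t + T), |inner ℝ w (x s - ξ)| ≤ C * ρ * L * M * A ^ 2 := by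
      intro s hs
      have hsub : uIcc t s ⊆ uIcc t (t + T) := by
        rw [uIcc_of_le hs.1, uIcc_of_le (hs.1.trans hs.2)]
        exact Icc_subset_Icc_right hs.2
      have hint := (innerSL ℝ w).intervalIntegral_comp_comm (h.2.2.2.1.mono_set hsub)
      simp only [innerSL_apply_apply] at hint
      rw [h.2.2.2.2 s hs, add_sub_cancel_left, ← hint, ← Real.norm_eq_abs]
      calc ‖∫ τ in t..s, inner ℝ w (velocity G (x τ) (u τ))‖
          ≤ ∫ τ in t..s, C * ρ * L * M * A * ‖u τ‖ := by
            refine intervalIntegral.norm_integral_le_of_norm_le hs.1 (ae_of_all _ fun τ hτ => ?_)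
              ((hu1.mono_set hsub).const_mul _)
            have hτ' : τ ∈ Icc t (t + T) := ⟨hτ.1.le, hτ.2.trans hs.2⟩
            -- At `ξ` the cost gradient is orthogonal to every velocity.
            have h0 : inner ℝ w (velocity G (x τ) (u τ))
                = inner ℝ w (velocity G (x τ) (u τ) - velocity G ξ (u τ)) := by
              rw [inner_sub_right, inner_velocity_eq_zero hQ hcrit, sub_zero]
            rw [h0]
            calc _ ≤ ‖w‖ * ‖velocity G (x τ) (u τ) - velocity G ξ (u τ)‖ := norm_inner_le_norm _ _
              _ ≤ (C * ρ) * (L * (M * A) * ‖u τ‖) := by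
                gcongr
                refine ((hGb _ (hball τ hτ') _).2 ξ (by linarith)).trans ?_
                gcongr
                exact hdisp τ hτ'
              _ = _ := by ring
        _ = C * ρ * L * M * A * ∫ τ in t..s, ‖u τ‖ := intervalIntegral.integral_const_mul _ _
        _ ≤ C * ρ * L * M * A * A := by
            gcongr
            exact intervalIntegral.integral_mono_interval le_rfl hs.1 hs.2
              (ae_of_all _ fun τ => norm_nonneg _) hu1
        _ = _ := by ring
    have hc : ∀ s ∈ Icc t (t + T), ξ.ofLp ⬝ᵥ Q.mulVec ξ.ofLp - 2 * (C * ρ * L * M * A ^ 2) ≤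
        (x s).ofLp ⬝ᵥ Q.mulVec (x s).ofLp := fun s hs => by
      linarith [le_quadForm hQ ξ (x s), neg_le_of_abs_le (hcross s hs)]
    refine le_trans ?_ (h.le_cost hT hRl hc)
    have hI0 : 0 ≤ I := intervalIntegral.integral_nonneg (by linarith) fun _ _ => by positivity
    have k1 : 2 * T * (C * ρ * L * M) * A ^ 2 ≤ 2 * T * (C * ρ * L * M) * (T * I) := by gcongr
    have k2 := mul_le_mul_of_nonneg_right hρ1.le hI0
    linarith
  · have hc : ∀ s ∈ Icc t (t + T), 0 ≤ (x s).ofLp ⬝ᵥ Q.mulVec (x s).ofLp := fun s _ => by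
      simpa using hQ.posSemidef.dotProduct_mulVec_nonneg (x s).ofLp
    refine le_trans ?_ (h.le_cost hT hRl hc)
    have hq : ξ.ofLp ⬝ᵥ Q.mulVec ξ.ofLp ≤ C * ρ ^ 2 :=
      (le_abs_self _).trans ((abs_quadForm_le Q ξ).trans (by gcongr))
    have k1 : (r / 2) ^ 2 ≤ M ^ 2 * (T * I) :=
      calc (r / 2) ^ 2 ≤ (M * A) ^ 2 := by gcongr
        _ = M ^ 2 * A ^ 2 := by ring
        _ ≤ _ := by gcongr
    have k2 : lam / 2 * (r / 2) ^ 2 ≤ lam / 2 * (M ^ 2 * (T * I)) := by gcongr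
    have k3 : (T * M ^ 2) * (T * (C * ρ ^ 2)) ≤ (T * M ^ 2) * (lam / 2 * I) := by linarith
    have k4 := le_of_mul_le_mul_left k3 (by positivity)
    have k5 : T * (ξ.ofLp ⬝ᵥ Q.mulVec ξ.ofLp) ≤ T * (C * ρ ^ 2) := by gcongr
    linarith

theorem isTrajectory_const {a b : ℝ} : IsTrajectory G a b ξ (fun _ => 0) (fun _ => ξ) :=
  ⟨continuousOn_const, by simp, by simp⟩

theorem isFeasible_zero (hU : 0 ∈ U) : IsFeasible G U t T ξ (fun _ => 0) (fun _ => ξ) :=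
  ⟨MemLp.zero', fun _ _ => hU, isTrajectory_const⟩

theorem cost_zero_const : cost Q R t T (fun _ => 0) (fun _ => ξ) =
    T * (ξ.ofLp ⬝ᵥ Q.mulVec ξ.ofLp) := by
  simp [cost, stageCost]

theorem exists_unique_optimal_zero (hG : ∀ i j, LocallyLipschitz (fun x => G x i j))
    (hQ : Q.PosDef) (hR : R.PosDef) (hU : 0 ∈ U) (hT : 0 < T) :
    ∃ ρ > 0, ∀ ξ : EuclideanSpace ℝ (Fin n), ‖ξ‖ ≤ ρ → Matrix.vecMul ξ.ofLp (Q * G ξ) = 0 →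
      ∀ t, IsOptimalControl G Q R U t T ξ (fun _ => 0) ∧
        ∀ u, IsOptimalControl G Q R U t T ξ u →
          u =ᵐ[volume.restrict (Icc t (t + T))] (fun _ => 0) := by
  obtain ⟨ρ, hρ, c, hc, H⟩ := exists_cost_ge (T := T) hG hQ hR hT
  refine ⟨ρ, hρ, fun ξ hξ hcrit t => ⟨⟨_, isFeasible_zero hU, fun v y h => ?_⟩, ?_⟩⟩
  · rw [cost_zero_const]
    have : 0 ≤ ∫ τ in t..(t + T), ‖v τ‖ ^ 2 :=
      intervalIntegral.integral_nonneg (by linarith) fun _ _ => by positivity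
    nlinarith [H ξ hξ hcrit U t v y h]
  · rintro u ⟨x, h, hopt⟩
    have h1 := H ξ hξ hcrit U t u x h
    have h2 := hopt _ _ (isFeasible_zero hU)
    rw [cost_zero_const] at h2
    have h3 : ∫ τ in Icc t (t + T), ‖u τ‖ ^ 2 = 0 := by
      rw [integral_Icc_eq_integral_Ioc, ← intervalIntegral.integral_of_le (by linarith)]
      refine le_antisymm ?_ (intervalIntegral.integral_nonneg (by linarith) fun _ _ => by positivity)
      exact nonpos_of_mul_nonpos_right (by linarith) hc
    rw [integral_eq_zero_iff_of_nonneg (fun _ => by positivity) h.1.norm.integrable_sq] at h3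
    filter_upwards [h3] with τ hτ
    simpa using hτ

/-! ### The closed loop at critical states -/

theorem isClosedLoop_const {δ : ℝ} (hopt : ∀ t, IsOptimalControl G Q R U t T ξ (fun _ => 0)) :
    IsClosedLoop G Q R U T δ (fun _ => 0) (fun _ => ξ) :=
  fun _ => ⟨⟨_, hopt _, fun _ _ => rfl⟩, isTrajectory_const⟩

/-- If the zero control is the only optimal control at `ξ`, then the closed loop cannot leave `ξ`. -/
theorem IsClosedLoop.eq_const {δ : ℝ} (hδ : 0 < δ) (hδT : δ ≤ T)
    (hopt : ∀ t u, IsOptimalControl G Q R U t T ξ u →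
      u =ᵐ[volume.restrict (Icc t (t + T))] (fun _ => 0))
    (h : IsClosedLoop G Q R U T δ u x) (h0 : x 0 = ξ) {t : ℝ} (ht : 0 ≤ t) : x t = ξ := by
  have step : ∀ k : ℕ, x (k * δ) = ξ → ∀ s ∈ Icc (k * δ) ((k + 1) * δ), x s = ξ := by
    intro k hk s hs
    obtain ⟨⟨v, hv, huv⟩, htraj⟩ := h k
    rw [hk] at hv htraj
    have hv0 := (ae_restrict_iff' measurableSet_Icc).1 (hopt _ v hv)
    rw [htraj.2.2 s hs]
    -- The right endpoint, where `u` and `v` may differ, is a null set.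
    have hne : ∀ᵐ τ : ℝ, τ ≠ (k + 1) * δ := by
      simp [ae_iff]
    rw [intervalIntegral.integral_congr_ae (g := fun _ => 0), intervalIntegral.integral_zero,
      add_zero]
    filter_upwards [hv0, hne] with τ hτ hτne hmem
    rw [uIoc_of_le hs.1] at hmem
    have hlt : τ < (k + 1) * δ := lt_of_le_of_ne (hmem.2.trans hs.2) hτne
    rw [huv τ ⟨hmem.1.le, hlt⟩, hτ ⟨hmem.1.le, by linarith⟩, velocity_zero]
  have node : ∀ k : ℕ, x (k * δ) = ξ := by
    intro k
    induction k with
    | zero => simpa using h0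
    | succ k ih =>
      push_cast
      exact step k ih _ ⟨by nlinarith, le_rfl⟩
  refine step ⌊t / δ⌋₊ (node _) t ⟨?_, ?_⟩
  · exact (le_div_iff₀ hδ).1 (Nat.floor_le (by positivity))
  · exact ((div_lt_iff₀ hδ).1 (Nat.lt_floor_add_one _)).le

end MPC
theorem theorem1 {n m : ℕ}
    (G : EuclideanSpace ℝ (Fin n) → Matrix (Fin n) (Fin m) ℝ)
    (hG : ∀ i j, LocallyLipschitz (fun x => G x i j))
    (Q : Matrix (Fin n) (Fin n) ℝ) (hQ : Q.PosDef)
    (R : Matrix (Fin m) (Fin m) ℝ) (hR : R.PosDef)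
    (U : Set (EuclideanSpace ℝ (Fin m))) (hU : 0 ∈ U)
    (h : ∀ ε > 0, ∃ x₀ : EuclideanSpace ℝ (Fin n), x₀ ≠ 0 ∧ ‖x₀‖ ≤ ε ∧
      Matrix.vecMul x₀.ofLp (Q * G x₀) = 0)
    (T : ℝ) (hT : 0 < T) :
    (∃ ρ > 0, ∀ x₀ : EuclideanSpace ℝ (Fin n), x₀ ≠ 0 → ‖x₀‖ ≤ ρ →
      Matrix.vecMul x₀.ofLp (Q * G x₀) = 0 →
        -- the zero control is the unique optimal control (up to null sets)
        (∀ t : ℝ, MPC.IsOptimalControl G Q R U t T x₀ (fun _ => 0) ∧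
          ∀ u, MPC.IsOptimalControl G Q R U t T x₀ u →
            u =ᵐ[volume.restrict (Icc t (t + T))] (fun _ => 0)) ∧
        -- the closed loop started at `x₀` exists and stays there forever
        (∀ δ : ℝ, 0 < δ → δ ≤ T →
          MPC.IsClosedLoop G Q R U T δ (fun _ => 0) (fun _ => x₀) ∧
          ∀ u x, MPC.IsClosedLoop G Q R U T δ u x → x 0 = x₀ → ∀ t, 0 ≤ t → x t = x₀)) ∧
    -- the origin is not asymptotically stabilized
    (∀ δ : ℝ, 0 < δ → δ ≤ T → ¬ MPC.IsAsymptoticallyStable G Q R U T δ) := by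
  obtain ⟨ρ, hρ, H⟩ := MPC.exists_unique_optimal_zero (T := T) hG hQ hR hU hT
  refine ⟨⟨ρ, hρ, fun x₀ _ hx₀ hcrit => ⟨H x₀ hx₀ hcrit, fun δ hδ hδT =>
    ⟨MPC.isClosedLoop_const fun t => (H x₀ hx₀ hcrit t).1, fun u x hux h0 t ht =>
      hux.eq_const hδ hδT (fun t => (H x₀ hx₀ hcrit t).2) h0 ht⟩⟩⟩, ?_⟩
  rintro δ - - ⟨-, r, hr, hattr⟩
  obtain ⟨x₀, hx₀, hle, hcrit⟩ := h (min ρ r) (lt_min hρ hr)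
  have hlim := hattr _ _ (MPC.isClosedLoop_const fun t =>
    (H x₀ (hle.trans (min_le_left _ _)) hcrit t).1) (hle.trans (min_le_right _ _))
  exact hx₀ (tendsto_nhds_unique tendsto_const_nhds hlim)
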